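/- Let $I\subset\mathbb R$ be an interval, $x_0\in I$, and let $Q:I\to\mathbb R$ be locally integrable. A **system of quadratures** $(s_1,\dots,s_n)$, $n\ge 1$, with integrands $\varphi_1,\dots,\varphi_n$ consists of functions $\varphi_j:I\times\mathbb R^{j-1}\to\mathbb R$ that are locally integrable in the first variable and continuously differentiable in the remaining variables, together with $$s_j(x,c_1,\dots,c_{j-1})=\int_{x_0}^x\varphi_j\bigl(t,\,s_1(t)+c_1,\dots,s_{j-1}(t,c_1,\dots,c_{j-2})+c_{j-1}\bigr)\,dt\qquad(x\in I,\ c_1,\dots,c_{j-1}\in\mathbb R),$$ where the integrands are assumed to be locally integrable in $t\in I$, so that the integrals exist. The system is **independent** if there are $c_1,\dots,c_{n-1}\in\mathbb R$ such that the functions $\varphi_1,\varphi_2(\cdot,c_1),\dots,\varphi_n(\cdot,c_1,\dots,c_{n-1}):I\to\mathbb R$ are linearly independent. A function $F:\mathbb R^n\to\mathbb R$ is **admissible** if it is four times continuously differentiable and $\partial_nF$ has no zeros. An **integral by quadratures in the restricted sense** is a family of functions on $I$, with parameters $c\in\mathbb R^n$, of the form $$f(x,c_1,\dots,c_n)=F\bigl(s_1(x)+c_1,\dots,s_n(x,c_1,\dots,c_{n-1})+c_n\bigr)\qquad(x\in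 I),$$ with $(s_1,\dots,s_n)$ an independent system of quadratures and $F$ admissible (for some $n\ge1$). The equation $u''+Qu=0$ **can be integrated by quadratures in the restricted sense** if there is an integral by quadratures in the restricted sense $f$ that is equivalent to the general solution of its Prüfer equation $$\theta'=\cos^2\theta+Q\sin^2\theta ,$$ that is, such that every $f(\cdot,c)$, $c\in\mathbb R^n$, is a solution on $I$ and every solution on $I$ equals $f(\cdot,c)$ for some $c\in\mathbb R^n$. Here a solution is a continuous function $\theta:I\to\mathbb R$ with $\theta(x)=\theta(x_0)+\int_{x_0}^x(\cos^2\theta+Q\sin^2\theta)\,dt$ for all $x\in I$. **Theorem 4.1.** If the equation $u''+Qu=0$ can be integrated by quadratures in the restricted sense, then $Q$ is constant, i.e. there is $q\in\mathbb R$ with $Q(x)=q$ for almost every $x\in I$. -/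

import Mathlib

open MeasureTheory Set

namespace Quadratures

/-- The first `k` entries of an `n`-tuple of integration constants, for an index `k < n`.
(With indices starting at `0`, these are the constants on which the `k`-th quadrature depends.) -/
def initial {n : ℕ} (k : Fin n) (c : Fin n → ℝ) : Fin (k : ℕ) → ℝ :=
  fun i => c (i.castLE k.isLt.le)

/-- The quadratures with base point `x₀` and integrands `φ 0, …, φ (n - 1)`:
`s_k (x, c_0, …, c_{k-1}) =
  ∫_{x₀}^x φ_k (t, s_0 (t) + c_0, …, s_{k-1} (t, c_0, …, c_{k-2}) + c_{k-1}) dt`. -/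
noncomputable def quadrature {n : ℕ} (x₀ : ℝ)
    (φ : (k : Fin n) → ℝ → (Fin (k : ℕ) → ℝ) → ℝ) (k : Fin n) (x : ℝ) (c : Fin (k : ℕ) → ℝ) : ℝ :=
  ∫ t in x₀..x, φ k t (fun i : Fin (k : ℕ) =>
    quadrature x₀ φ (i.castLE k.isLt.le) t (fun l => c (l.castLE i.isLt.le)) + c i)
termination_by (k : ℕ)
decreasing_by exact i.isLt

/-- The point `(s_0 (x) + c_0, …, s_{n-1} (x, c_0, …, c_{n-2}) + c_{n-1})` of `ℝⁿ`. -/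
noncomputable def quadraturePoint {n : ℕ} (x₀ : ℝ)
    (φ : (k : Fin n) → ℝ → (Fin (k : ℕ) → ℝ) → ℝ) (c : Fin n → ℝ) (x : ℝ) : Fin n → ℝ :=
  fun k => quadrature x₀ φ k x (initial k c) + c k

/-- `φ 0, …, φ (n - 1)` are the integrands of a system of quadratures on the interval `I`:
each is locally integrable in the first variable and continuously differentiable in the others,
and the integrals that define the quadratures exist. -/
def IsSystem {n : ℕ} (I : Set ℝ) (x₀ : ℝ)
    (φ : (k : Fin n) → ℝ → (Fin (k : ℕ) → ℝ) → ℝ) : Prop :=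
  ∀ k : Fin n,
    (∀ y : Fin (k : ℕ) → ℝ, LocallyIntegrableOn (fun t => φ k t y) I volume) ∧
    (∀ t ∈ I, ContDiff ℝ 1 (φ k t)) ∧
    (∀ c : Fin n → ℝ, LocallyIntegrableOn
      (fun t => φ k t (initial k (quadraturePoint x₀ φ c t))) I volume)

/-- Independence of a system: for some values of the constants, the functions
`φ_0, φ_1 (·, c_0), …, φ_{n-1} (·, c_0, …, c_{n-2}) : I → ℝ` are linearly independent. -/
def IsIndependent {n : ℕ} (I : Set ℝ)
    (φ : (k : Fin n) → ℝ → (Fin (k : ℕ) → ℝ) → ℝ) : Prop :=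
  ∃ c : Fin n → ℝ,
    LinearIndependent ℝ (fun k : Fin n => fun x : I => φ k (x : ℝ) (initial k c))

/-- A function of `n + 1` real variables is admissible if it is four times continuously
differentiable and its partial derivative in the last variable has no zeros. -/
def IsAdmissible {n : ℕ} (F : (Fin (n + 1) → ℝ) → ℝ) : Prop :=
  ContDiff ℝ 4 F ∧ ∀ y, fderiv ℝ F y (Pi.single (Fin.last n) 1) ≠ 0

/-- The family `f`, of functions `f c` with parameters `c ∈ ℝⁿ⁺¹`, is an integral by quadratures
in the restricted sense:
`f (x, c) = F (s_0 (x) + c_0, …, s_n (x, c_0, …, c_{n-1}) + c_n)` for `x ∈ I`. -/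
def IsRestrictedIntegral {n : ℕ} (I : Set ℝ) (x₀ : ℝ) (f : (Fin (n + 1) → ℝ) → ℝ → ℝ) : Prop :=
  ∃ (φ : (k : Fin (n + 1)) → ℝ → (Fin (k : ℕ) → ℝ) → ℝ) (F : (Fin (n + 1) → ℝ) → ℝ),
    IsSystem I x₀ φ ∧ IsIndependent I φ ∧ IsAdmissible F ∧
    ∀ c, ∀ x ∈ I, f c x = F (quadraturePoint x₀ φ c x)

/-- Two families of functions on `I` are equivalent if they consist of the same functions. -/
def FamilyEquivalent {ι κ : Type*} (I : Set ℝ) (f : ι → ℝ → ℝ) (g : κ → ℝ → ℝ) : Prop :=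
  (∀ c, ∃ d, EqOn (f c) (g d) I) ∧ (∀ d, ∃ c, EqOn (g d) (f c) I)

/-- `θ` is a solution on `I` (in the sense of Carathéodory) of the Prüfer equation
`θ' = cos² θ + Q sin² θ` of `u'' + Q u = 0`. -/
def IsPrueferSolution (I : Set ℝ) (x₀ : ℝ) (Q θ : ℝ → ℝ) : Prop :=
  ContinuousOn θ I ∧ ∀ x ∈ I,
    θ x = θ x₀ + ∫ t in x₀..x, (Real.cos (θ t) ^ 2 + Q t * Real.sin (θ t) ^ 2)

/-- The general solution of the Prüfer equation: the family of all its solutions on `I`. -/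
def prueferGeneralSolution (I : Set ℝ) (x₀ : ℝ) (Q : ℝ → ℝ) :
    {θ : ℝ → ℝ // IsPrueferSolution I x₀ Q θ} → ℝ → ℝ :=
  fun θ => θ.1

/-- The equation `u'' + Q u = 0` can be integrated by quadratures in the restricted sense on `I`:
the general solution of its Prüfer equation is equivalent to an integral by quadratures in the
restricted sense. -/
def IntegrableByRestrictedQuadratures (I : Set ℝ) (x₀ : ℝ) (Q : ℝ → ℝ) : Prop :=
  ∃ (n : ℕ) (f : (Fin (n + 1) → ℝ) → ℝ → ℝ),
    IsRestrictedIntegral I x₀ f ∧ FamilyEquivalent I (prueferGeneralSolution I x₀ Q) f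

end Quadratures

namespace Quadratures

open Filter Topology
open scoped commutatorElement

/-! Let `g_x` in SL(2, ℝ) be the fundamental matrix of `u'' + Q u = 0` that is the identity at `x₀`,
and let `T_x` map `c` to the point with entries `s_k (x, c) + c_k`. Since `T_{x₀}` is the identity,
the solution with constants `c` starts at the angle `F c`. By Prüfer's substitution, `g_x` carries
the line of angle `F c` to the line of angle `F (T_x c)`.

Each `T_x` is triangular: it shifts every entry by an amount that depends on the earlier entries
only. Triangular permutations form a solvable group, because commutators fix one entry more
(`commutator_triangularSubgroup_le`). As `F` is not constant, its values give three distinct lines,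
so a matrix compatible with the identity permutation is scalar. Hence the matrices compatible with
triangular permutations form a group that is solvable modulo scalars, and some nonscalar `h`
commutes with all `g_x h g_x⁻¹` (`exists_noncentral_commute_conj`).

The traceless part `N` of `g_x h g_x⁻¹` is therefore proportional to that of `h` for every `x`,
while `N' = [J, N]` with `J = (0, 1; -Q, 0)`. Together these express `Q x` by the entries of `h`
alone (`potential_eq_of_hasDerivAt`). -/

/-! ### Absolute continuity and derivatives almost everywhere -/

theorem _root_.ContDiff.comp_absolutelyContinuousOnInterval {g f : ℝ → ℝ} {a b : ℝ}
    (hg : ContDiff ℝ 1 g) (hf : AbsolutelyContinuousOnInterval f a b) :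
    AbsolutelyContinuousOnInterval (fun x => g (f x)) a b := by
  -- `f` is bounded on the interval, and `g` is Lipschitz on a compact interval that contains the
  -- values of `f`.
  obtain ⟨C, hC⟩ := hf.exists_bound
  obtain ⟨K, hK⟩ := (hg.contDiffOn (s := Icc (-C) C)).exists_lipschitzOnWith one_ne_zero
    (convex_Icc _ _) isCompact_Icc
  have hmem : ∀ x ∈ uIcc a b, f x ∈ Icc (-C) C := fun x hx => abs_le.1 (hC x hx)
  unfold AbsolutelyContinuousOnInterval at hf ⊢
  have hlim := hf.const_mul (K : ℝ)
  rw [mul_zero] at hlim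
  refine squeeze_zero' (Eventually.of_forall fun E => Finset.sum_nonneg fun i _ => dist_nonneg)
    ?_ hlim
  filter_upwards [mem_inf_of_right (mem_principal_self _)] with E hE
  rw [Finset.mul_sum]
  refine Finset.sum_le_sum fun i hi => ?_
  exact hK.dist_le_mul _ (hmem _ (hE.1 i hi).1) _ (hmem _ (hE.1 i hi).2)

/-- A property that holds almost everywhere on all compact subintervals of an interval with a
fixed endpoint holds almost everywhere on its interior. -/
theorem ae_interior_of_forall_uIcc {I : Set ℝ} {x₀ : ℝ} {p : ℝ → Prop}
    (h : ∀ x₁ ∈ I, ∀ᵐ x, x ∈ uIcc x₀ x₁ → p x) : ∀ᵐ x, x ∈ interior I → p x := by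
  rw [ae_iff]
  refine measure_null_of_locally_null _ fun x hx => ?_
  simp only [mem_ofPred_eq, Classical.not_imp] at hx
  obtain ⟨ε, hε, hsub⟩ := Metric.mem_nhds_iff.1 (mem_interior_iff_mem_nhds.1 hx.1)
  have hl : x - ε / 2 ∈ I := hsub (by rw [Metric.mem_ball, Real.dist_eq, abs_lt]; constructor <;> linarith)
  have hr : x + ε / 2 ∈ I := hsub (by rw [Metric.mem_ball, Real.dist_eq, abs_lt]; constructor <;> linarith)
  refine ⟨{y | ¬ (y ∈ uIcc x₀ (x - ε / 2) → p y)} ∪ {y | ¬ (y ∈ uIcc x₀ (x + ε / 2) → p y)}, ?_,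
    measure_union_null (ae_iff.1 (h _ hl)) (ae_iff.1 (h _ hr))⟩
  have hIoo : Ioo (x - ε / 2) (x + ε / 2) ∈ 𝓝 x := Ioo_mem_nhds (by linarith) (by linarith)
  filter_upwards [mem_nhdsWithin_of_mem_nhds hIoo, self_mem_nhdsWithin] with y hy hyp
  simp only [Classical.not_imp] at hyp
  simp only [mem_union, mem_ofPred_eq, Classical.not_imp]
  rcases le_total x₀ y with h0 | h0
  · exact Or.inr ⟨mem_uIcc.2 (Or.inl ⟨h0, hy.2.le⟩), hyp.2⟩
  · exact Or.inl ⟨mem_uIcc.2 (Or.inr ⟨hy.1.le, h0⟩), hyp.2⟩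

theorem ae_mem_interior_of_mem {I : Set ℝ} (hI : I.OrdConnected) :
    ∀ᵐ x : ℝ, x ∈ I → x ∈ interior I := by
  have h := hI.convex.addHaar_frontier (volume : Measure ℝ)
  filter_upwards [measure_eq_zero_iff_ae_notMem.1 h] with x hx hxI
  by_contra hint
  exact hx ⟨subset_closure hxI, hint⟩

theorem ae_hasDerivAt_integral_interior {I : Set ℝ} {x₀ : ℝ} {g : ℝ → ℝ}
    (hg : ∀ x₁ ∈ I, IntervalIntegrable g volume x₀ x₁) :
    ∀ᵐ x, x ∈ interior I → HasDerivAt (fun x => ∫ t in x₀..x, g t) (g x) x :=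
  ae_interior_of_forall_uIcc fun x₁ hx₁ => by
    filter_upwards [(hg x₁ hx₁).ae_hasDerivAt_integral] with x hx hmem
    exact hx hmem x₀ left_mem_uIcc

/-! ### The linear equation and Prüfer's substitution -/

/-- `(u, u')` solves the linear system of `u'' + Q u = 0` on `I` in the sense of Carathéodory. -/
structure IsLinearSolution (I : Set ℝ) (x₀ : ℝ) (Q u v : ℝ → ℝ) : Prop where
  fst : ∀ x₁ ∈ I, AbsolutelyContinuousOnInterval u x₀ x₁
  snd : ∀ x₁ ∈ I, AbsolutelyContinuousOnInterval v x₀ x₁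
  deriv : ∀ᵐ x, x ∈ interior I → HasDerivAt u (v x) x ∧ HasDerivAt v (-(Q x * u x)) x

namespace IsLinearSolution

variable {I : Set ℝ} {x₀ : ℝ} {Q u v u' v' : ℝ → ℝ}

theorem add (h : IsLinearSolution I x₀ Q u v) (h' : IsLinearSolution I x₀ Q u' v') :
    IsLinearSolution I x₀ Q (fun x => u x + u' x) (fun x => v x + v' x) where
  fst x₁ hx₁ := (h.fst x₁ hx₁).add (h'.fst x₁ hx₁)
  snd x₁ hx₁ := (h.snd x₁ hx₁).add (h'.snd x₁ hx₁)
  deriv := by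
    filter_upwards [h.deriv, h'.deriv] with x hx hx' hxI
    refine ⟨(hx hxI).1.add (hx' hxI).1, ?_⟩
    exact ((hx hxI).2.add (hx' hxI).2).congr_deriv (by ring)

theorem const_mul (h : IsLinearSolution I x₀ Q u v) (c : ℝ) :
    IsLinearSolution I x₀ Q (fun x => c * u x) (fun x => c * v x) where
  fst x₁ hx₁ := (h.fst x₁ hx₁).const_mul c
  snd x₁ hx₁ := (h.snd x₁ hx₁).const_mul c
  deriv := by
    filter_upwards [h.deriv] with x hx hxI
    refine ⟨(hx hxI).1.const_mul c, ?_⟩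
    exact ((hx hxI).2.const_mul c).congr_deriv (by ring)

/-- The Wronskian of two solutions is constant. -/
theorem wronskian_eq (hI : I.OrdConnected) (hx₀ : x₀ ∈ I) (h : IsLinearSolution I x₀ Q u v)
    (h' : IsLinearSolution I x₀ Q u' v') {x : ℝ} (hx : x ∈ I) :
    u x * v' x - u' x * v x = u x₀ * v' x₀ - u' x₀ * v x₀ := by
  have hac := ((h.fst x hx).fun_mul (h'.snd x hx)).fun_sub ((h'.fst x hx).fun_mul (h.snd x hx))
  have hd : ∀ᵐ t, t ∈ uIcc x₀ x → HasDerivAt (fun t => u t * v' t - u' t * v t) 0 t := by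
    filter_upwards [h.deriv, h'.deriv, ae_mem_interior_of_mem hI] with t ht ht' hint hmem
    have htI := hint (hI.uIcc_subset hx₀ hx hmem)
    exact (((ht htI).1.mul (ht' htI).2).sub ((ht' htI).1.mul (ht htI).2)).congr_deriv (by ring)
  obtain ⟨C, hC⟩ := hac.const_of_ae_hasDerivAt_zero hd
  exact (hC x right_mem_uIcc).trans (hC x₀ left_mem_uIcc).symm

end IsLinearSolution

/-- Prüfer's substitution: a solution of the Prüfer equation is the polar angle of a solution
of the linear equation. -/
theorem IsPrueferSolution.exists_isLinearSolution {I : Set ℝ} (hI : I.OrdConnected) {x₀ : ℝ}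
    (hx₀ : x₀ ∈ I) {Q θ : ℝ → ℝ} (hQ : LocallyIntegrableOn Q I volume)
    (hθ : IsPrueferSolution I x₀ Q θ) :
    ∃ u v r : ℝ → ℝ, IsLinearSolution I x₀ Q u v ∧ r x₀ = 1 ∧ (∀ x, 0 < r x) ∧
      ∀ x ∈ I, u x = r x * Real.sin (θ x) ∧ v x = r x * Real.cos (θ x) := by
  obtain ⟨hcont, heq⟩ := hθ
  have hsub : ∀ x₁ ∈ I, uIcc x₀ x₁ ⊆ I := fun x₁ hx₁ => hI.uIcc_subset hx₀ hx₁
  have hQi : ∀ x₁ ∈ I, IntervalIntegrable Q volume x₀ x₁ := fun x₁ hx₁ =>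
    (hQ.integrableOn_compact_subset (hsub x₁ hx₁) isCompact_uIcc).intervalIntegrable
  have hsin : ContinuousOn (fun t => Real.sin (θ t)) I := Real.continuous_sin.comp_continuousOn hcont
  have hcos : ContinuousOn (fun t => Real.cos (θ t)) I := Real.continuous_cos.comp_continuousOn hcont
  set g : ℝ → ℝ := fun t => Real.cos (θ t) ^ 2 + Q t * Real.sin (θ t) ^ 2 with hgdef
  -- `k` is the logarithmic derivative of the radius in polar coordinates.
  set k : ℝ → ℝ := fun t => (1 - Q t) * (Real.sin (θ t) * Real.cos (θ t)) with hkdef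
  have hg : ∀ x₁ ∈ I, IntervalIntegrable g volume x₀ x₁ := fun x₁ hx₁ =>
    ((hcos.pow 2).mono (hsub x₁ hx₁)).intervalIntegrable.add
      ((hQi x₁ hx₁).mul_continuousOn ((hsin.pow 2).mono (hsub x₁ hx₁)))
  have hk : ∀ x₁ ∈ I, IntervalIntegrable k volume x₀ x₁ := fun x₁ hx₁ =>
    (intervalIntegrable_const.sub (hQi x₁ hx₁)).mul_continuousOn
      ((hsin.mul hcos).mono (hsub x₁ hx₁))
  -- `η` agrees with `θ` on `I`; being an integral, it is absolutely continuous and differentiable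
  -- almost everywhere.
  set η : ℝ → ℝ := fun x => θ x₀ + ∫ t in x₀..x, g t with hηdef
  set r : ℝ → ℝ := fun x => Real.exp (∫ t in x₀..x, k t) with hrdef
  have hηθ : ∀ x ∈ I, η x = θ x := fun x hx => (heq x hx).symm
  have hηac : ∀ x₁ ∈ I, AbsolutelyContinuousOnInterval η x₀ x₁ := fun x₁ hx₁ =>
    ContDiff.comp_absolutelyContinuousOnInterval (g := fun y => θ x₀ + y) (by fun_prop)
      ((hg x₁ hx₁).absolutelyContinuousOnInterval_intervalIntegral left_mem_uIcc)
  have hrac : ∀ x₁ ∈ I, AbsolutelyContinuousOnInterval r x₀ x₁ := fun x₁ hx₁ =>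
    Real.contDiff_exp.comp_absolutelyContinuousOnInterval
      ((hk x₁ hx₁).absolutelyContinuousOnInterval_intervalIntegral left_mem_uIcc)
  refine ⟨fun x => r x * Real.sin (η x), fun x => r x * Real.cos (η x), r, ⟨fun x₁ hx₁ => ?_,
    fun x₁ hx₁ => ?_, ?_⟩, by simp [hrdef], fun x => Real.exp_pos _, fun x hx => ?_⟩
  · exact (hrac x₁ hx₁).fun_mul (Real.contDiff_sin.comp_absolutelyContinuousOnInterval (hηac x₁ hx₁))
  · exact (hrac x₁ hx₁).fun_mul (Real.contDiff_cos.comp_absolutelyContinuousOnInterval (hηac x₁ hx₁))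
  · filter_upwards [ae_hasDerivAt_integral_interior hg, ae_hasDerivAt_integral_interior hk]
      with x hgx hkx hx
    have hη' : HasDerivAt η (g x) x := (hgx hx).const_add (θ x₀)
    have hr' : HasDerivAt r (r x * k x) x := (hkx hx).exp
    have e := hηθ x (interior_subset hx)
    have sc := Real.sin_sq_add_cos_sq (θ x)
    constructor
    · refine (hr'.mul hη'.sin).congr_deriv ?_
      rw [e, hgdef, hkdef]
      linear_combination r x * Real.cos (θ x) * sc
    · refine (hr'.mul hη'.cos).congr_deriv ?_
      rw [e, hgdef, hkdef]
      linear_combination -r x * Q x * Real.sin (θ x) * sc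
  · simp only [hηθ x hx, and_self]

/-! ### Triangular permutations form a solvable group -/

/-- The `j`-th entry of `σ y - y` depends only on the entries of `y` before the `j`-th. -/
def IsTriangular {n : ℕ} (σ : (Fin n → ℝ) → Fin n → ℝ) : Prop :=
  ∀ j y z, (∀ i < j, y i = z i) → σ y j - y j = σ z j - z j

namespace IsTriangular

variable {n : ℕ} {σ τ : (Fin n → ℝ) → Fin n → ℝ}

theorem apply_congr (hσ : IsTriangular σ) {j : Fin n} {y z : Fin n → ℝ}
    (h : ∀ i < j, y i = z i) : ∀ i < j, σ y i = σ z i := by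
  intro i hi
  have := hσ i y z fun l hl => h l (hl.trans hi)
  linarith [h i hi]

theorem eq_of_apply_eq (hσ : IsTriangular σ) {y z : Fin n → ℝ} (j : Fin n)
    (h : ∀ i ≤ j, σ y i = σ z i) : y j = z j := by
  induction j using WellFoundedLT.induction with
  | ind j ih =>
    have := hσ j y z fun i hi => ih i hi fun l hl => h l (hl.trans hi.le)
    linarith [h j le_rfl]

theorem comp (hσ : IsTriangular σ) (hτ : IsTriangular τ) : IsTriangular fun y => σ (τ y) := by
  intro j y z h
  linarith [hσ j _ _ (hτ.apply_congr h), hτ j y z h]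

/-- The equation `σ y = z` is solved entry by entry, each step being a translation of the next
entry. -/
theorem bijective (hσ : IsTriangular σ) : Function.Bijective σ := by
  refine ⟨fun y z h => funext fun j => hσ.eq_of_apply_eq j fun i _ => by rw [h], fun z => ?_⟩
  have key : ∀ k ≤ n, ∃ y, ∀ i : Fin n, (i : ℕ) < k → σ y i = z i := by
    intro k
    induction k with
    | zero => exact fun _ => ⟨z, fun i hi => absurd hi (Nat.not_lt_zero _)⟩
    | succ k ih =>
      intro hk
      obtain ⟨y, hy⟩ := ih (by omega)
      set K : Fin n := ⟨k, hk⟩ with hK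
      have hup : ∀ i < K, Function.update y K (y K + z K - σ y K) i = y i := fun i hi =>
        Function.update_of_ne hi.ne _ _
      refine ⟨Function.update y K (y K + z K - σ y K), fun i hi => ?_⟩
      rcases Nat.lt_succ_iff_lt_or_eq.1 hi with h | h
      · rw [hσ.apply_congr hup i h, hy i h]
      · have hi' : i = K := Fin.ext h
        rw [hi']
        have := hσ K _ _ hup
        rw [Function.update_self] at this
        linarith
  obtain ⟨y, hy⟩ := key n le_rfl
  exact ⟨y, funext fun i => hy i i.isLt⟩

theorem inv {σ : Equiv.Perm (Fin n → ℝ)} (hσ : IsTriangular σ) :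
    IsTriangular (σ⁻¹ : Equiv.Perm (Fin n → ℝ)) := by
  intro j y z h
  have h' : ∀ i < j, σ⁻¹ y i = σ⁻¹ z i := fun i hi => hσ.eq_of_apply_eq i fun l hl => by
    simpa using h l (hl.trans_lt hi)
  have hi : ∀ w, σ (σ⁻¹ w) = w := σ.apply_symm_apply
  have := hσ j _ _ h'
  rw [hi, hi] at this
  linarith

end IsTriangular

/-- The triangular permutations of `ℝⁿ` that preserve the first `k` entries. -/
def triangularSubgroup (n k : ℕ) : Subgroup (Equiv.Perm (Fin n → ℝ)) where
  carrier := {σ | IsTriangular σ ∧ ∀ j : Fin n, (j : ℕ) < k → ∀ y, σ y j = y j}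
  one_mem' := ⟨fun _ _ _ _ => by simp, fun _ _ _ => rfl⟩
  mul_mem' hσ hτ := ⟨hσ.1.comp hτ.1, fun j hj y => (hσ.2 j hj _).trans (hτ.2 j hj y)⟩
  inv_mem' {σ} hσ := ⟨hσ.1.inv, fun j hj y => by simpa using (hσ.2 j hj (σ⁻¹ y)).symm⟩

/-- Once the first `k` entries are preserved, the next entry is translated by amounts that neither
map changes for the other, and translations of `ℝ` commute. -/
theorem commutator_triangularSubgroup_le (n k : ℕ) :
    ⁅triangularSubgroup n k, triangularSubgroup n k⁆ ≤ triangularSubgroup n (k + 1) := by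
  rw [Subgroup.commutator_le]
  intro σ hσ τ hτ
  refine ⟨(mul_mem (mul_mem (mul_mem hσ hτ) (inv_mem hσ)) (inv_mem hτ)).1, fun j hj y => ?_⟩
  obtain ⟨w, rfl⟩ : ∃ w, y = (τ * σ) w := ⟨(τ * σ)⁻¹ y, by simp⟩
  have h1 : ⁅σ, τ⁆ ((τ * σ) w) = σ (τ w) := by simp [commutatorElement_def]
  rw [h1]
  change σ (τ w) j = τ (σ w) j
  have e1 := hσ.1 j (τ w) w fun i hi => hτ.2 i (by have := Fin.lt_def.1 hi; omega) w
  have e2 := hτ.1 j (σ w) w fun i hi => hσ.2 i (by have := Fin.lt_def.1 hi; omega) w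
  linarith

theorem triangularSubgroup_self (n : ℕ) : triangularSubgroup n n = ⊥ := by
  rw [eq_bot_iff]
  intro σ hσ
  exact Equiv.ext fun y => funext fun j => hσ.2 j j.isLt y

theorem map_mem_triangularSubgroup_of_mem_derivedSeries {G : Type*} [Group G] {n : ℕ}
    (τ : G →* Equiv.Perm (Fin n → ℝ)) (hτ : ∀ g, τ g ∈ triangularSubgroup n 0) (k : ℕ) :
    ∀ g ∈ derivedSeries G k, τ g ∈ triangularSubgroup n k := by
  change derivedSeries G k ≤ (triangularSubgroup n k).comap τ
  induction k with
  | zero => exact fun g _ => hτ g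
  | succ k ih =>
    rw [derivedSeries_succ, Subgroup.commutator_le]
    intro g hg g' hg'
    rw [Subgroup.mem_comap, map_commutatorElement]
    exact commutator_triangularSubgroup_le n k
      (Subgroup.commutator_mem_commutator (ih hg) (ih hg'))

/-! ### Matrices acting on the projective line -/

/-- The pairs of a permutation of `X` and a matrix with determinant one that correspond to each
other under `e : X → ℝ²`, up to nonzero scalar factors. -/
def projectivelyCompatible {X : Type*} (e : X → Fin 2 → ℝ) :
    Subgroup (Equiv.Perm X × Matrix.SpecialLinearGroup (Fin 2) ℝ) where
  carrier := {p | ∀ y, ∃ c : ℝ, c ≠ 0 ∧ p.2.1.mulVec (e y) = c • e (p.1 y)}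
  one_mem' y := ⟨1, one_ne_zero, by simp⟩
  mul_mem' {p p'} hp hp' y := by
    obtain ⟨c', hc', h'⟩ := hp' y
    obtain ⟨c, hc, h⟩ := hp (p'.1 y)
    refine ⟨c' * c, mul_ne_zero hc' hc, ?_⟩
    simp only [Prod.snd_mul, Matrix.SpecialLinearGroup.coe_mul, Prod.fst_mul, Equiv.Perm.mul_apply]
    rw [← Matrix.mulVec_mulVec, h', Matrix.mulVec_smul, h, smul_smul]
  inv_mem' {p} hp y := by
    obtain ⟨c, hc, h⟩ := hp (p.1⁻¹ y)
    refine ⟨c⁻¹, inv_ne_zero hc, ?_⟩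
    rw [show p.1 (p.1⁻¹ y) = y from p.1.apply_symm_apply y] at h
    have h1 : e y = c⁻¹ • p.2.1.mulVec (e (p.1⁻¹ y)) := by
      rw [h, smul_smul, inv_mul_cancel₀ hc, one_smul]
    have h2 : (p.2⁻¹).1 * p.2.1 = 1 := by
      rw [← Matrix.SpecialLinearGroup.coe_mul, inv_mul_cancel, Matrix.SpecialLinearGroup.coe_one]
    simp only [Prod.snd_inv, Prod.fst_inv]
    rw [h1, Matrix.mulVec_smul, Matrix.mulVec_mulVec, h2, Matrix.one_mulVec]

theorem mem_center_iff_entries (g : Matrix.SpecialLinearGroup (Fin 2) ℝ) :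
    g ∈ Subgroup.center (Matrix.SpecialLinearGroup (Fin 2) ℝ) ↔
      g.1 0 1 = 0 ∧ g.1 1 0 = 0 ∧ g.1 0 0 = g.1 1 1 := by
  have hdet := g.2
  rw [Matrix.det_fin_two] at hdet
  rw [Matrix.SpecialLinearGroup.mem_center_iff]
  constructor
  · rintro ⟨r, -, hr⟩
    rw [← hr]
    simp
  · rintro ⟨h1, h2, h3⟩
    refine ⟨g.1 0 0, ?_, ?_⟩
    · rw [h1, h2, ← h3] at hdet
      simp only [Fintype.card_fin]
      linear_combination hdet
    · ext i j
      fin_cases i <;> fin_cases j <;> simp [h1, h2, h3]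

/-- A matrix with three distinct eigenlines is scalar. -/
theorem mem_center_of_three_eigenlines (g : Matrix.SpecialLinearGroup (Fin 2) ℝ)
    (v : Fin 3 → Fin 2 → ℝ) (hv : ∀ i j, i ≠ j → v i 0 * v j 1 - v i 1 * v j 0 ≠ 0)
    (hg : ∀ i, ∃ c : ℝ, g.1.mulVec (v i) = c • v i) :
    g ∈ Subgroup.center (Matrix.SpecialLinearGroup (Fin 2) ℝ) := by
  -- `v` and `g v` are parallel exactly when a binary quadratic form vanishes at `v`; with three
  -- distinct roots, the form is zero.
  have key : ∀ i, g.1 0 1 * v i 1 ^ 2 + (g.1 0 0 - g.1 1 1) * (v i 0 * v i 1)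
      - g.1 1 0 * v i 0 ^ 2 = 0 := by
    intro i
    obtain ⟨c, hc⟩ := hg i
    have h0 := congrFun hc 0
    have h1 := congrFun hc 1
    simp only [Matrix.mulVec, dotProduct, Fin.sum_univ_two, Pi.smul_apply, smul_eq_mul] at h0 h1
    linear_combination v i 1 * h0 - v i 0 * h1
  have k0 := key 0
  have k1 := key 1
  have k2 := key 2
  have hD : (v 0 0 * v 1 1 - v 0 1 * v 1 0) * (v 0 0 * v 2 1 - v 0 1 * v 2 0)
      * (v 1 0 * v 2 1 - v 1 1 * v 2 0) ≠ 0 :=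
    mul_ne_zero (mul_ne_zero (hv 0 1 (by decide)) (hv 0 2 (by decide))) (hv 1 2 (by decide))
  generalize v 0 0 = a0 at *
  generalize v 0 1 = b0 at *
  generalize v 1 0 = a1 at *
  generalize v 1 1 = b1 at *
  generalize v 2 0 = a2 at *
  generalize v 2 1 = b2 at *
  rw [mem_center_iff_entries]
  refine ⟨?_, ?_, ?_⟩
  · refine (mul_eq_zero.1 ?_).resolve_right hD
    linear_combination a1 * a2 * (a1 * b2 - a2 * b1) * k0 - a0 * a2 * (a0 * b2 - a2 * b0) * k1
      + a0 * a1 * (a0 * b1 - a1 * b0) * k2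
  · refine (mul_eq_zero.1 ?_).resolve_right hD
    linear_combination -b1 * b2 * (a1 * b2 - a2 * b1) * k0 + b0 * b2 * (a0 * b2 - a2 * b0) * k1
      - b0 * b1 * (a0 * b1 - a1 * b0) * k2
  · refine sub_eq_zero.1 ((mul_eq_zero.1 ?_).resolve_right hD)
    linear_combination -(a1 * b2 + a2 * b1) * (a1 * b2 - a2 * b1) * k0
      + (a0 * b2 + a2 * b0) * (a0 * b2 - a2 * b0) * k1
      - (a0 * b1 + a1 * b0) * (a0 * b1 - a1 * b0) * k2

/-- Elements of `SL(2, ℝ)` that commute modulo the center commute. -/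
theorem commute_of_commutator_mem_center (a b : Matrix.SpecialLinearGroup (Fin 2) ℝ)
    (h : ⁅a, b⁆ ∈ Subgroup.center (Matrix.SpecialLinearGroup (Fin 2) ℝ)) : Commute a b := by
  have hab : a * b = ⁅a, b⁆ * (b * a) := by rw [commutatorElement_def]; group
  have hz := (mem_center_iff_entries _).1 h
  generalize ⁅a, b⁆ = z at *
  obtain ⟨z1, z2, z3⟩ := hz
  have hdz := z.2
  have hda := a.2
  have hdb := b.2
  rw [Matrix.det_fin_two] at hdz hda hdb
  rw [z1, z2, ← z3] at hdz
  have hm : ∀ i j, (a.1 * b.1) i j = z.1 0 0 * (b.1 * a.1) i j := by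
    intro i j
    rw [← Matrix.SpecialLinearGroup.coe_mul, hab, Matrix.SpecialLinearGroup.coe_mul,
      Matrix.SpecialLinearGroup.coe_mul]
    fin_cases i <;> simp [Matrix.mul_apply, Fin.sum_univ_two, z1, z2, z3]
  have hz1 : z.1 0 0 = 1 ∨ z.1 0 0 = -1 := by
    rw [← sq_eq_one_iff]; linarith
  rcases hz1 with hz1 | hz1
  · ext i j
    have := hm i j
    rw [hz1, one_mul] at this
    simpa using this
  -- If `a b = -b a`, both traces vanish, and the determinant conditions make a sum of squares zero,
  -- which is impossible over `ℝ`.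
  · exfalso
    have e00 := hm 0 0
    have e01 := hm 0 1
    have e10 := hm 1 0
    have e11 := hm 1 1
    simp only [Matrix.mul_apply, Fin.sum_univ_two, hz1] at e00 e01 e10 e11
    generalize a.1 0 0 = a1 at *
    generalize a.1 0 1 = a2 at *
    generalize a.1 1 0 = a3 at *
    generalize a.1 1 1 = a4 at *
    generalize b.1 0 0 = b1 at *
    generalize b.1 0 1 = b2 at *
    generalize b.1 1 0 = b3 at *
    generalize b.1 1 1 = b4 at *
    have ta : a4 = -a1 := by
      linear_combination (1 / 2) * (b4 * e00 - b3 * e01 - b2 * e10 + b1 * e11) - (a1 + a4) * hdb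
    have tb : b4 = -b1 := by
      linear_combination (1 / 2) * (a4 * e00 - a3 * e01 - a2 * e10 + a1 * e11) - (b1 + b4) * hda
    subst ta tb
    have h0 : (a2 * b1 - a1 * b2) ^ 2 + a2 ^ 2 + b2 ^ 2 = 0 := by
      linear_combination -a2 * b2 * e00 - b2 ^ 2 * hda - a2 ^ 2 * hdb
    have ha2 : a2 = 0 := by nlinarith [sq_nonneg (a2 * b1 - a1 * b2), sq_nonneg a2, sq_nonneg b2]
    subst ha2
    nlinarith [sq_nonneg a1]

/-- Take `h` in the image of the last derived subgroup whose image is not central. Commutators of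
`h` with its conjugates lie in the next one, so they are central. If the whole image is central, any
nonscalar `h` will do. -/
theorem exists_noncentral_commute_conj {G : Type*} [Group G]
    (ρ : G →* Matrix.SpecialLinearGroup (Fin 2) ℝ) (k : ℕ)
    (hk : ∀ g ∈ derivedSeries G k, ρ g ∈ Subgroup.center (Matrix.SpecialLinearGroup (Fin 2) ℝ)) :
    ∃ h ∉ Subgroup.center (Matrix.SpecialLinearGroup (Fin 2) ℝ),
      ∀ g, Commute (ρ g * h * (ρ g)⁻¹) h := by
  induction k with
  | zero =>
    obtain ⟨h, hh⟩ : ∃ h : Matrix.SpecialLinearGroup (Fin 2) ℝ, h.1 0 1 ≠ 0 :=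
      ⟨⟨!![1, 1; 0, 1], by simp [Matrix.det_fin_two]⟩, by simp⟩
    refine ⟨h, fun hc => hh ((mem_center_iff_entries h).1 hc).1, fun g => ?_⟩
    · have := Subgroup.mem_center_iff.1 (hk g (by simp)) h
      rw [← this, mul_inv_cancel_right]
  | succ k ih =>
    by_cases hc : ∀ g ∈ derivedSeries G k,
        ρ g ∈ Subgroup.center (Matrix.SpecialLinearGroup (Fin 2) ℝ)
    · exact ih hc
    · push Not at hc
      obtain ⟨w, hw, hwc⟩ := hc
      refine ⟨ρ w, hwc, fun g => commute_of_commutator_mem_center _ _ ?_⟩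
      have hconj := (derivedSeries_normal G k).conj_mem w hw g
      have := hk _ (by
        rw [derivedSeries_succ]
        exact Subgroup.commutator_mem_commutator hconj hw)
      simpa [map_commutatorElement] using this

/-! ### Quadratures as triangular maps -/

theorem isTriangular_quadraturePoint {n : ℕ} (x₀ : ℝ)
    (φ : (k : Fin n) → ℝ → (Fin (k : ℕ) → ℝ) → ℝ) (x : ℝ) :
    IsTriangular fun c => quadraturePoint x₀ φ c x := by
  intro j y z h
  have : initial j y = initial j z := funext fun i => h _ (Fin.lt_def.2 i.isLt)
  simp [quadraturePoint, this]

theorem quadraturePoint_self {n : ℕ} (x₀ : ℝ)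
    (φ : (k : Fin n) → ℝ → (Fin (k : ℕ) → ℝ) → ℝ) (c : Fin n → ℝ) :
    quadraturePoint x₀ φ c x₀ = c := by
  funext k
  rw [quadraturePoint, quadrature]
  simp

/-- The direction in the phase plane that corresponds to a value of the Prüfer angle. -/
noncomputable def direction (θ : ℝ) : Fin 2 → ℝ := ![Real.sin θ, Real.cos θ]

/-! ### Conjugation by the fundamental matrix -/

/-- If the conjugates of a nonscalar matrix with traceless part `(a, b; c, -a)` by the fundamental
matrix `(p, q; r, s)` of `u'' + Q u = 0` commute with that matrix, then `Q` is determined by it. -/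
theorem potential_eq_of_hasDerivAt {p q r s : ℝ → ℝ} {x Qx a b c : ℝ}
    (hp : HasDerivAt p (r x) x) (hq : HasDerivAt q (s x) x)
    (hr : HasDerivAt r (-(Qx * p x)) x) (hs : HasDerivAt s (-(Qx * q x)) x)
    (hdet : p x * s x - q x * r x = 1) (hne : ¬ (a = 0 ∧ b = 0 ∧ c = 0))
    (h₁ : ∀ᶠ t in 𝓝 x, a * (-2 * a * p t * q t - c * q t ^ 2 + b * p t ^ 2)
      = b * (a * (p t * s t + q t * r t) + c * q t * s t - b * p t * r t))
    (h₂ : ∀ᶠ t in 𝓝 x, a * (2 * a * r t * s t + c * s t ^ 2 - b * r t ^ 2)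
      = c * (a * (p t * s t + q t * r t) + c * q t * s t - b * p t * r t))
    (h₃ : b * (2 * a * r x * s x + c * s x ^ 2 - b * r x ^ 2)
      = c * (-2 * a * p x * q x - c * q x ^ 2 + b * p x ^ 2)) :
    Qx = -(2 * a ^ 2 + b * c) / b ^ 2 := by
  -- The conjugate has traceless part `N = (A, B; C, -A)`, and `N' = [J, N]` reads `A' = C + Q B`,
  -- `B' = -2 A`, `C' = -2 Q A`.
  have dA : HasDerivAt (fun t => a * (p t * s t + q t * r t) + c * q t * s t - b * p t * r t)
      ((2 * a * r x * s x + c * s x ^ 2 - b * r x ^ 2)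
        + Qx * (-2 * a * p x * q x - c * q x ^ 2 + b * p x ^ 2)) x := by
    refine ((((hp.mul hs).add (hq.mul hr)).const_mul a).add ((hq.const_mul c).mul hs)
      |>.sub ((hp.const_mul b).mul hr)).congr_deriv ?_
    ring
  have dB : HasDerivAt (fun t => -2 * a * p t * q t - c * q t ^ 2 + b * p t ^ 2)
      (-2 * (a * (p x * s x + q x * r x) + c * q x * s x - b * p x * r x)) x := by
    refine ((((hp.const_mul (-2 * a)).mul hq).sub ((hq.pow 2).const_mul c)).add
      ((hp.pow 2).const_mul b)).congr_deriv ?_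
    push_cast
    ring
  have dC : HasDerivAt (fun t => 2 * a * r t * s t + c * s t ^ 2 - b * r t ^ 2)
      (-2 * Qx * (a * (p x * s x + q x * r x) + c * q x * s x - b * p x * r x)) x := by
    refine ((((hr.const_mul (2 * a)).mul hs).add ((hs.pow 2).const_mul c)).sub
      ((hr.pow 2).const_mul b)).congr_deriv ?_
    push_cast
    ring
  have e₁ := ((dB.const_mul a).congr_of_eventuallyEq (f₁ := fun t => b * _)
    (h₁.mono fun t ht => ht.symm)).unique (dA.const_mul b)
  have e₂ := ((dC.const_mul a).congr_of_eventuallyEq (f₁ := fun t => c * _)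
    (h₂.mono fun t ht => ht.symm)).unique (dA.const_mul c)
  have k₁ := h₁.self_of_nhds
  have k₂ := h₂.self_of_nhds
  generalize p x = p at *
  generalize q x = q at *
  generalize r x = r at *
  generalize s x = s at *
  obtain ⟨A, hA⟩ : ∃ A, A = a * (p * s + q * r) + c * q * s - b * p * r := ⟨_, rfl⟩
  obtain ⟨B, hB⟩ : ∃ B, B = -2 * a * p * q - c * q ^ 2 + b * p ^ 2 := ⟨_, rfl⟩
  obtain ⟨C, hC⟩ : ∃ C, C = 2 * a * r * s + c * s ^ 2 - b * r ^ 2 := ⟨_, rfl⟩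
  rw [← hA, ← hB, ← hC] at e₁ e₂
  rw [← hA, ← hB] at k₁
  rw [← hA, ← hC] at k₂
  rw [← hB, ← hC] at h₃
  -- Conjugating back recovers `b` and `c` from `A`, `B`, `C`; the determinant is preserved.
  have ib : b = 2 * s * q * A - q ^ 2 * C + s ^ 2 * B := by
    rw [hA, hB, hC]
    linear_combination -b * (p * s - q * r + 1) * hdet
  have ic : c = -2 * p * r * A + p ^ 2 * C - r ^ 2 * B := by
    rw [hA, hB, hC]
    linear_combination -c * (p * s - q * r + 1) * hdet
  have hdetA : A ^ 2 + B * C = a ^ 2 + b * c := by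
    rw [hA, hB, hC]
    linear_combination (a ^ 2 + b * c) * (p * s - q * r + 1) * hdet
  -- If `b = 0`, proportionality and its derivative force the traceless part of the conjugate, and
  -- with it that of the original matrix, to vanish.
  have hb : b ≠ 0 := by
    rintro rfl
    have hc : c ≠ 0 := by
      rintro rfl
      have ha : a ≠ 0 := fun ha => hne ⟨ha, rfl, rfl⟩
      have hB0 : B = 0 := (mul_eq_zero.1 (k₁.trans (zero_mul _))).resolve_left ha
      have hA0 : A = 0 := by
        refine (mul_eq_zero.1 (?_ : a * A = 0)).resolve_left ha
        linear_combination (-1 / 2) * e₁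
      rw [hA0, hB0] at hdetA
      exact ha (pow_eq_zero_iff two_ne_zero |>.1 (by linarith))
    have hB0 : B = 0 := (mul_eq_zero.1 (h₃.symm.trans (zero_mul _))).resolve_left hc
    have haA : a * A = 0 := by linear_combination (-1 / 2) * e₁
    have hC0 : C = 0 := by
      refine (mul_eq_zero.1 (?_ : c * C = 0)).resolve_left hc
      rw [hB0] at e₂
      linear_combination -e₂ - 2 * Qx * haA
    have hA0 : A = 0 := by
      refine (mul_eq_zero.1 (?_ : c * A = 0)).resolve_left hc
      rw [← k₂, hC0, mul_zero]
    rw [hA0, hB0, hC0] at ic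
    exact hc (by linarith)
  have hB0 : B ≠ 0 := by
    intro hB0
    rw [hB0, mul_zero] at k₁ h₃
    have hA0 : A = 0 := (mul_eq_zero.1 k₁.symm).resolve_left hb
    have hC0 : C = 0 := (mul_eq_zero.1 h₃).resolve_left hb
    rw [hA0, hB0, hC0] at ib
    exact hb (by linarith)
  rw [eq_div_iff (pow_ne_zero 2 hb)]
  refine mul_left_cancel₀ hB0 ?_
  linear_combination -b * e₁ - b * h₃ + 2 * a * k₁

theorem IsLinearSolution.exists_fundamental {I : Set ℝ} {x₀ : ℝ} {Q u v u' v' : ℝ → ℝ}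
    (h : IsLinearSolution I x₀ Q u v) (h' : IsLinearSolution I x₀ Q u' v')
    (hne : u x₀ * v' x₀ - u' x₀ * v x₀ ≠ 0) :
    ∃ p q r s : ℝ → ℝ, IsLinearSolution I x₀ Q p r ∧ IsLinearSolution I x₀ Q q s ∧
      p x₀ = 1 ∧ q x₀ = 0 ∧ r x₀ = 0 ∧ s x₀ = 1 := by
  set δ := u x₀ * v' x₀ - u' x₀ * v x₀ with hδ
  -- Cramer's rule for the prescribed values at `x₀`.
  refine ⟨_, _, _, _, (h.const_mul (v' x₀ / δ)).add (h'.const_mul (-v x₀ / δ)),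
    (h.const_mul (-u' x₀ / δ)).add (h'.const_mul (u x₀ / δ)), ?_, ?_, ?_, ?_⟩
  all_goals
    field_simp
    try rw [hδ]
    ring

/-- A nonconstant continuous real function on a connected space has three values that are
pairwise different modulo `π`. -/
theorem exists_three_angles {X : Type*} [TopologicalSpace X] [PreconnectedSpace X] {F : X → ℝ}
    (hF : Continuous F) {y₀ y₁ : X} (h : F y₀ < F y₁) :
    ∃ y : Fin 3 → X, ∀ i j, i ≠ j → Real.sin (F (y i) - F (y j)) ≠ 0 := by
  -- The three values are spaced by `d / 2`; since `d ≤ 1 < π`, they stay distinct modulo `π`.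
  set d := min (F y₁ - F y₀) 1 with hd
  have hd0 : 0 < d := lt_min (by linarith) one_pos
  have hd1 : d ≤ 1 := min_le_right _ _
  have hd2 : d ≤ F y₁ - F y₀ := min_le_left _ _
  have hi : ∀ i : Fin 3, (0 : ℝ) ≤ (i : ℕ) ∧ ((i : ℕ) : ℝ) ≤ 2 := fun i =>
    ⟨Nat.cast_nonneg _, by exact_mod_cast Nat.lt_succ_iff.1 i.isLt⟩
  have hex : ∀ i : Fin 3, ∃ y, F y = F y₀ + (i : ℕ) * (d / 2) := fun i =>
    mem_range_of_exists_le_of_exists_ge hF ⟨y₀, by nlinarith [hi i]⟩ ⟨y₁, by nlinarith [hi i]⟩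
  choose y hy using hex
  refine ⟨y, fun i j hij hsin => ?_⟩
  have hdiff : F (y i) - F (y j) = (((i : ℕ) : ℝ) - (j : ℕ)) * (d / 2) := by
    rw [hy, hy]
    ring
  have hpi := Real.pi_gt_three
  rw [hdiff, Real.sin_eq_zero_iff_of_lt_of_lt (by nlinarith [hi i, hi j])
    (by nlinarith [hi i, hi j]), mul_eq_zero] at hsin
  rcases hsin with h0 | h0
  · exact hij (Fin.ext (by exact_mod_cast sub_eq_zero.1 h0))
  · linarith

theorem IsAdmissible.exists_lt {n : ℕ} {F : (Fin (n + 1) → ℝ) → ℝ} (hF : IsAdmissible F) :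
    ∃ y₀ y₁, F y₀ < F y₁ := by
  by_contra! h
  have : F = fun _ => F 0 := funext fun y => le_antisymm (h 0 y) (h y 0)
  refine hF.2 0 ?_
  rw [this]
  simp

/-! ### Solvability of the flow -/

/-- If the flow of the linear equation, given by its fundamental matrix, is semiconjugate on the
projective line to triangular permutations of `ℝⁿ`, then some nonscalar matrix commutes with all
its conjugates by the fundamental matrix. -/
theorem exists_noncentral_commute_conj_of_triangular {n : ℕ} {F : (Fin n → ℝ) → ℝ}
    (hF : Continuous F) {y₀ y₁ : Fin n → ℝ} (hlt : F y₀ < F y₁) :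
    ∃ h ∉ Subgroup.center (Matrix.SpecialLinearGroup (Fin 2) ℝ),
      ∀ (g : Matrix.SpecialLinearGroup (Fin 2) ℝ) (T : (Fin n → ℝ) → Fin n → ℝ),
        IsTriangular T →
        (∀ y, ∃ c : ℝ, c ≠ 0 ∧ g.1.mulVec (direction (F y)) = c • direction (F (T y))) →
        Commute (g * h * g⁻¹) h := by
  set K := (triangularSubgroup n 0).prod ⊤ ⊓ projectivelyCompatible fun y => direction (F y)
    with hK
  obtain ⟨y, hy⟩ := exists_three_angles hF hlt
  obtain ⟨h, hh, hcomm⟩ := exists_noncentral_commute_conj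
    ((MonoidHom.snd _ _).comp K.subtype) n fun w hw => by
      -- On the `n`-th derived subgroup the permutation is trivial, so the matrix fixes every line
      -- of angle `F y`.
      have hτ : w.1.1 ∈ triangularSubgroup n n := map_mem_triangularSubgroup_of_mem_derivedSeries
        ((MonoidHom.fst _ _).comp K.subtype) (fun w => w.2.1.1) n w hw
      rw [triangularSubgroup_self, Subgroup.mem_bot] at hτ
      refine mem_center_of_three_eigenlines _ (fun i => direction (F (y i))) (fun i j hij => ?_)
        fun i => ?_
      · have := hy i j hij
        rw [Real.sin_sub] at this
        simpa [direction] using this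
      · obtain ⟨c, -, hc⟩ := w.2.2 (y i)
        rw [hτ] at hc
        exact ⟨c, hc⟩
  refine ⟨h, hh, fun g T hT hg => ?_⟩
  exact hcomm ⟨(Equiv.ofBijective T hT.bijective, g),
    ⟨⟨⟨hT, fun _ hj => absurd hj (Nat.not_lt_zero _)⟩, trivial⟩, hg⟩⟩

/-- Two by two matrices commute exactly when the cross product of their traceless parts vanishes;
these are its three components. -/
theorem commute_conj_entries {g h : Matrix.SpecialLinearGroup (Fin 2) ℝ}
    (hcomm : Commute (g * h * g⁻¹) h) {p q r s a b c : ℝ} (hp : g.1 0 0 = p) (hq : g.1 0 1 = q)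
    (hr : g.1 1 0 = r) (hs : g.1 1 1 = s) (ha : (h.1 0 0 - h.1 1 1) / 2 = a)
    (hb : h.1 0 1 = b) (hc : h.1 1 0 = c) :
    a * (-2 * a * p * q - c * q ^ 2 + b * p ^ 2)
        = b * (a * (p * s + q * r) + c * q * s - b * p * r) ∧
      a * (2 * a * r * s + c * s ^ 2 - b * r ^ 2)
        = c * (a * (p * s + q * r) + c * q * s - b * p * r) ∧
      b * (2 * a * r * s + c * s ^ 2 - b * r ^ 2)
        = c * (-2 * a * p * q - c * q ^ 2 + b * p ^ 2) := by
  have hm : g.1 * h.1 * (g.1).adjugate * h.1 = h.1 * (g.1 * h.1 * (g.1).adjugate) := by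
    have := congrArg Subtype.val hcomm.eq
    simpa only [Matrix.SpecialLinearGroup.coe_mul, Matrix.SpecialLinearGroup.coe_inv] using this
  have e00 := congrFun (congrFun hm 0) 0
  have e01 := congrFun (congrFun hm 0) 1
  have e10 := congrFun (congrFun hm 1) 0
  simp only [Matrix.mul_apply, Fin.sum_univ_two, Matrix.adjugate_fin_two, Matrix.of_apply,
    Matrix.cons_val', Matrix.cons_val_zero, Matrix.cons_val_one, Matrix.cons_val_fin_one,
    hp, hq, hr, hs, hb, hc] at e00 e01 e10
  obtain ha' : h.1 0 0 = h.1 1 1 + 2 * a := by linarith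
  rw [ha'] at e00 e01 e10
  refine ⟨?_, ?_, ?_⟩
  · linear_combination (-1 / 2) * e01
  · linear_combination (1 / 2) * e10
  · linear_combination -e00

end Quadratures

/-! ### The main theorem -/

theorem theorem4p1 (I : Set ℝ) (hI : I.OrdConnected) (x₀ : ℝ) (hx₀ : x₀ ∈ I)
    (Q : ℝ → ℝ) (hQ : LocallyIntegrableOn Q I volume)
    (h : Quadratures.IntegrableByRestrictedQuadratures I x₀ Q) :
    ∃ q : ℝ, ∀ᵐ x ∂(volume.restrict I), Q x = q := by
  open Quadratures in
  obtain ⟨n, f, ⟨φ, F, -, -, hF, hf⟩, -, hsol⟩ := h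
  choose θ hθ using hsol
  have hθF : ∀ c, ∀ x ∈ I, (θ c).1 x = F (quadraturePoint x₀ φ c x) := fun c x hx =>
    (hθ c hx).symm.trans (hf c x hx)
  choose u v ρ huv hρ₀ hρ huv' using fun c =>
    (θ c).2.exists_isLinearSolution hI hx₀ hQ
  have hu : ∀ c, ∀ x ∈ I, u c x = ρ c x * Real.sin (F (quadraturePoint x₀ φ c x)) :=
    fun c x hx => by rw [(huv' c x hx).1, hθF c x hx]
  have hv : ∀ c, ∀ x ∈ I, v c x = ρ c x * Real.cos (F (quadraturePoint x₀ φ c x)) :=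
    fun c x hx => by rw [(huv' c x hx).2, hθF c x hx]
  have hu₀ : ∀ c, u c x₀ = Real.sin (F c) := fun c => by
    rw [hu c x₀ hx₀, hρ₀, one_mul, quadraturePoint_self]
  have hv₀ : ∀ c, v c x₀ = Real.cos (F c) := fun c => by
    rw [hv c x₀ hx₀, hρ₀, one_mul, quadraturePoint_self]
  obtain ⟨y₀, y₁, hlt⟩ := hF.exists_lt
  obtain ⟨y, hy⟩ := exists_three_angles hF.1.continuous hlt
  -- Two solutions of the given family whose initial angles differ modulo `π` supply the fundamental
  -- system.
  obtain ⟨p, q, r, s, hpr, hqs, hp₀, hq₀, hr₀, hs₀⟩ :=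
    (huv (y 0)).exists_fundamental (huv (y 1)) (by
      have := hy 0 1 (by decide)
      rw [Real.sin_sub] at this
      rw [hu₀, hv₀, hu₀, hv₀]
      convert this using 1
      ring)
  have hdet : ∀ x ∈ I, p x * s x - q x * r x = 1 := fun x hx => by
    rw [hpr.wronskian_eq hI hx₀ hqs hx, hp₀, hs₀, hq₀, hr₀]
    norm_num
  obtain ⟨M, hMc, hcomm⟩ := exists_noncentral_commute_conj_of_triangular hF.1.continuous hlt
  have key : ∀ x ∈ I, ∃ g : Matrix.SpecialLinearGroup (Fin 2) ℝ,
      (g.1 0 0 = p x ∧ g.1 0 1 = q x ∧ g.1 1 0 = r x ∧ g.1 1 1 = s x) ∧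
        Commute (g * M * g⁻¹) M := by
    intro x hx
    obtain ⟨g, hg⟩ : ∃ g : Matrix.SpecialLinearGroup (Fin 2) ℝ, g.1 = !![p x, q x; r x, s x] :=
      ⟨⟨_, by rw [Matrix.det_fin_two]; exact hdet x hx⟩, rfl⟩
    refine ⟨g, by simp [hg], hcomm g _ (isTriangular_quadraturePoint x₀ φ x) fun c =>
      ⟨ρ c x, (hρ c x).ne', ?_⟩⟩
    -- Constancy of the Wronskians with the fundamental system expresses `(u c, v c)` as the
    -- fundamental matrix applied to its value at `x₀`.
    have w₁ := hpr.wronskian_eq hI hx₀ (huv c) hx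
    have w₂ := hqs.wronskian_eq hI hx₀ (huv c) hx
    rw [hp₀, hr₀, hu₀, hv₀] at w₁
    rw [hq₀, hs₀, hu₀, hv₀] at w₂
    have hd := hdet x hx
    have e₁ : p x * Real.sin (F c) + q x * Real.cos (F c) = u c x := by
      linear_combination -q x * w₁ + p x * w₂ + u c x * hd
    have e₂ : r x * Real.sin (F c) + s x * Real.cos (F c) = v c x := by
      linear_combination -s x * w₁ + r x * w₂ + v c x * hd
    rw [hu c x hx] at e₁
    rw [hv c x hx] at e₂
    rw [hg]
    ext i
    fin_cases i <;> simp [direction, Matrix.mulVec, dotProduct, Fin.sum_univ_two, e₁, e₂]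
  rw [mem_center_iff_entries] at hMc
  choose! g hg using key
  have hentries := fun x hx => commute_conj_entries (hg x hx).2 (hg x hx).1.1 (hg x hx).1.2.1
    (hg x hx).1.2.2.1 (hg x hx).1.2.2.2 rfl rfl rfl
  refine ⟨-(2 * ((M.1 0 0 - M.1 1 1) / 2) ^ 2 + M.1 0 1 * M.1 1 0) / M.1 0 1 ^ 2, ?_⟩
  rw [ae_restrict_iff' hI.measurableSet]
  filter_upwards [ae_mem_interior_of_mem hI, hpr.deriv, hqs.deriv] with x hint hxp hxq hxI
  have hxi := hint hxI
  have hnhds : ∀ᶠ t in nhds x, t ∈ I := mem_interior_iff_mem_nhds.1 hxi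
  refine potential_eq_of_hasDerivAt (hxp hxi).1 (hxq hxi).1 (hxp hxi).2 (hxq hxi).2 (hdet x hxI)
    (fun h0 => hMc ⟨h0.2.1, h0.2.2, by linarith [h0.1]⟩)
    (hnhds.mono fun t ht => (hentries t ht).1) (hnhds.mono fun t ht => (hentries t ht).2.1)
    (hentries x hxI).2.2
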